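/- Let $n\ge 1$ be an integer and let $\mathbb{U}=\{z\in\mathbb{C}:|z|<1\}$. Let $\mathcal{A}_n$ be the class of functions analytic in $\mathbb{U}$ of the form $f(z)=z+a_{n+1}z^{n+1}+a_{n+2}z^{n+2}+\cdots$. For $0<\mu\le 1$ let $\mathcal{STS}(\mu)$ be the class of those $f\in\mathcal{A}_n$ for which $f(z)\ne 0$ for $0<|z|<1$ and $$\left|\arg\left(\frac{zf'(z)}{f(z)}\right)\right|<\frac{\pi}{2}\mu\qquad(z\in\mathbb{U}),$$ where the quotient has the value $1$ at $z=0$, and put $$\phi(\mu)=\frac{\pi}{2}(\mu+1)-\arctan\frac{\cos\frac{\mu\pi}{2}}{\sin\frac{\mu\pi}{2}+\frac{n\mu}{1-\mu}\left(\frac{1-\mu}{1+\mu}\right)^{\frac{1+\mu}{2}}}\quad(0<\mu<1),\qquad \phi(1)=\lim_{\mu\to1^-}\phi(\mu)=\pi.$$ Here $\arg$ is the principal argument, and a bound on $|\arg w|$ includes the assertion $w\ne 0$. Let $0<\mu\le 1$, let $\alpha,\gamma>0$ and $\beta$ be real numbers with $$\alpha=\beta+\frac{2}{\pi}\arctan(n\beta),\qquad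 \beta=\gamma+\frac{2}{\pi}\arctan(n\gamma),\qquad \frac{\pi}{2}(\alpha+\gamma)\le\phi(\mu),$$ and let $f\in\mathcal{A}_n$ satisfy $$|\arg(f'(z)+zf''(z))|<\frac{\pi}{2}\alpha\qquad(z\in\mathbb{U}).$$ Then $f\in\mathcal{STS}(\mu)$. -/

import Mathlib

/-- The open unit disk. -/
def unitDisk : Set ℂ := Metric.ball 0 1

/-- The class `𝒜ₙ`: functions analytic in the open unit disk with the expansion
`f(z) = z + a_{n+1} z^{n+1} + a_{n+2} z^{n+2} + ⋯` there. -/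
def classA (n : ℕ) : Set (ℂ → ℂ) :=
  {f | AnalyticOnNhd ℂ f unitDisk ∧
    ∃ a : ℕ → ℂ, ∀ z ∈ unitDisk,
      HasSum (fun k : ℕ => a (n + 1 + k) * z ^ (n + 1 + k)) (f z - z)}

/-- `|arg w| < c`, for the principal argument. The argument of `0` is undefined, so the
inequality includes `w ≠ 0`. -/
def AbsArgLt (w : ℂ) (c : ℝ) : Prop := w ≠ 0 ∧ |Complex.arg w| < c

/-- The class `𝒮𝒯𝒮(μ)` of strongly starlike functions of order `μ` in `𝒜ₙ`, for `0 < μ ≤ 1`.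
At `z = 0` the quotient `z f'(z) / f(z)` has a removable singularity with value `1`, whose
argument is `0`, so the condition is only stated for `z ≠ 0`; there it includes that
`f z ≠ 0`, so that the quotient is defined. -/
def classSTS (n : ℕ) (μ : ℝ) : Set (ℂ → ℂ) :=
  {f | f ∈ classA n ∧ 0 < μ ∧ μ ≤ 1 ∧
    ∀ z ∈ unitDisk, z ≠ 0 →
      f z ≠ 0 ∧ AbsArgLt (z * deriv f z / f z) (Real.pi / 2 * μ)}

/-- The bound `ϕ(μ)`. For `μ = 1` the term with `1 - μ` in the denominator is to be read as a
limit, which gives `ϕ(1) = π`; the formula below has that value too (see `phi_one`). -/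
noncomputable def phi (n : ℕ) (μ : ℝ) : ℝ :=
  Real.pi / 2 * (μ + 1) -
    Real.arctan (Real.cos (μ * Real.pi / 2) /
      (Real.sin (μ * Real.pi / 2) +
        n * μ / (1 - μ) * ((1 - μ) / (1 + μ)) ^ ((1 + μ) / 2)))

theorem phi_one (n : ℕ) : phi n 1 = Real.pi := by
  simp [phi]
  ring

/-! Put `q = f/z` and `P = zf'/f = f'/q`. Since `f' = q + zq'`, the sector lemma
`absArgLt_of_absArgLt_add_mul_deriv` applies twice: the bound on `f' + z(f')'` gives `|arg f'| <
πβ/2`, and this gives `|arg q| < πγ/2`. The identity `P² + zP' = (f' + zf'')/q` then yields an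
argument of `P² + zP'` below `π(α+γ)/2 ≤ ϕ(μ)`, which `absArgLt_of_sq_add_mul_deriv` turns into
`|arg P| < πμ/2`.

Both sector lemmas look at a first exit point `z₀`. There Nunokawa's lemma (Jack's lemma after a
power and a Cayley transform) makes `z₀p'/p` purely imaginary and bounds it below, so the expression
in the hypothesis has too large an angle. In the second lemma that angle depends on `a =
|P(z₀)|^(1/μ)`, and minimizing over `a` produces the constant in `ϕ`. -/

open Complex Filter Topology Asymptotics

/-! ### Boundary derivatives and Jack's lemma. -/

/-- If the real part of `G` on the disk `‖z‖ < ‖z₀‖` is bounded by its value at the boundary point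
`z₀`, then `z₀ G'(z₀)` is real and nonnegative. -/
theorem mul_deriv_of_re_le_boundary {G : ℂ → ℂ} {G' z₀ : ℂ} (hz₀ : z₀ ≠ 0)
    (hG : HasDerivAt G G' z₀) (hle : ∀ᶠ z in 𝓝 z₀, ‖z‖ < ‖z₀‖ → (G z).re ≤ (G z₀).re) :
    0 ≤ (z₀ * G').re ∧ (z₀ * G').im = 0 := by
  have key : ∀ v : ℂ, 0 < v.re → 0 ≤ (v * (z₀ * G')).re := by
    intro v hv
    have hγ : HasDerivAt (fun s : ℝ => z₀ * (1 - (s : ℂ) * v)) (z₀ * -v) 0 := by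
      have h1 : HasDerivAt (fun s : ℝ => (s : ℂ)) 1 0 := Complex.ofRealCLM.hasDerivAt
      simpa using ((h1.mul_const v).const_sub 1).const_mul z₀
    have hG0 : HasDerivAt G G' (z₀ * (1 - ((0 : ℝ) : ℂ) * v)) := by simpa using hG
    have hd : HasDerivAt (fun s : ℝ => G (z₀ * (1 - (s : ℂ) * v))) (G' * (z₀ * -v)) 0 :=
      HasDerivAt.comp (0 : ℝ) hG0 hγ
    have hre : HasDerivAt (fun s : ℝ => (G (z₀ * (1 - (s : ℂ) * v))).re)
        (G' * (z₀ * -v)).re 0 := (Complex.reCLM.hasFDerivAt.comp_hasDerivAt (0 : ℝ) hd)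
    have hsl := hre.tendsto_slope_zero_right
    have hcont : Tendsto (fun s : ℝ => z₀ * (1 - (s : ℂ) * v)) (𝓝[>] 0) (𝓝 z₀) := by
      have := hγ.continuousAt.tendsto
      simp only [ofReal_zero, zero_mul, sub_zero, mul_one] at this
      exact this.mono_left nhdsWithin_le_nhds
    have hvn : 0 < normSq v := normSq_pos.2 (fun h => by simp [h] at hv)
    -- `|1 - sv|² = 1 - 2s Re v + s²|v|²` is below `1` exactly for `0 < s < 2 Re v / |v|²`.
    have hsmall : ∀ᶠ s : ℝ in 𝓝[>] 0, s < 2 * v.re / normSq v :=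
      nhdsWithin_le_nhds (Iio_mem_nhds (by positivity))
    have hnonpos : (G' * (z₀ * -v)).re ≤ 0 := by
      refine le_of_tendsto hsl ?_
      filter_upwards [hcont.eventually hle, hsmall, self_mem_nhdsWithin] with s h1 h2 (h3 : 0 < s)
      have hnorm : ‖1 - (s : ℂ) * v‖ < 1 := by
        rw [← sq_lt_one_iff₀ (norm_nonneg _), ← normSq_eq_norm_sq]
        rw [lt_div_iff₀ hvn] at h2
        simp only [normSq_apply, sub_re, one_re, re_ofReal_mul, sub_im, one_im, im_ofReal_mul] at *
        nlinarith
      have hlt : ‖z₀ * (1 - (s : ℂ) * v)‖ < ‖z₀‖ := by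
        rw [norm_mul]
        exact mul_lt_of_lt_one_right (norm_pos_iff.2 hz₀) hnorm
      have := h1 hlt
      simp only [zero_add, ofReal_zero, zero_mul, sub_zero, mul_one, smul_eq_mul]
      exact mul_nonpos_of_nonneg_of_nonpos (inv_nonneg.2 h3.le) (by linarith)
    have e : G' * (z₀ * -v) = -(v * (z₀ * G')) := by ring
    rw [e, neg_re] at hnonpos
    linarith
  set A := z₀ * G'
  refine ⟨by simpa using key 1 (by simp), ?_⟩
  by_contra him
  -- This `v` makes `Re (vA) = -1`.
  have := key ⟨1, (A.re + 1) / A.im⟩ (by simp)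
  simp only [mul_re, one_mul, div_mul_cancel₀ _ him] at this
  linarith

/-- **Jack's lemma** for functions vanishing to order `m + 1` at the origin. -/
theorem jack_lemma {h : ℂ → ℂ} {h' z₀ : ℂ} {m : ℕ} (hz₀ : z₀ ≠ 0) (h0 : h 0 = 0)
    (hd : DifferentiableOn ℂ h (Metric.ball 0 ‖z₀‖)) (hlt : ∀ z, ‖z‖ < ‖z₀‖ → ‖h z‖ ≤ 1)
    (ho : h =o[𝓝 0] fun z => ‖z‖ ^ m) (hz : HasDerivAt h h' z₀) (hone : ‖h z₀‖ = 1) :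
    ∃ k : ℝ, (m + 1 : ℕ) ≤ k ∧ z₀ * h' = k * h z₀ := by
  have hr : 0 < ‖z₀‖ := norm_pos_iff.2 hz₀
  have hne : h z₀ ≠ 0 := norm_ne_zero_iff.1 (by rw [hone]; norm_num)
  have schwarz : ∀ z, ‖z‖ < ‖z₀‖ → ‖h z‖ ≤ (‖z‖ / ‖z₀‖) ^ (m + 1) := by
    intro z hzz
    have := Complex.dist_le_mul_div_pow_of_mapsTo_ball_of_isLittleO (f := h) (c := 0) (z := z)
      (R₁ := ‖z₀‖) (R₂ := 1) (n := m) hd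
      (fun w hw => by simpa [h0] using hlt w (by simpa using hw)) (by simpa [h0] using ho)
      (by simpa using hzz)
    simpa [h0] using this
  -- By `schwarz` this quotient has modulus at most `1` inside and equals `1` at `z₀`; its
  -- logarithmic derivative there, times `z₀`, is `z₀h'/h(z₀) - (m+1)`.
  have hG : HasDerivAt (fun z => h z / h z₀ / (z / z₀) ^ (m + 1))
      ((h' / h z₀ * (z₀ / z₀) ^ (m + 1)
        - h z₀ / h z₀ * (((m + 1 : ℕ) : ℂ) * (z₀ / z₀) ^ m * (1 / z₀))) /
        ((z₀ / z₀) ^ (m + 1)) ^ 2) z₀ := by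
    refine (hz.div_const _).div ?_ (by simp [hz₀])
    simpa using ((hasDerivAt_id z₀).div_const z₀).fun_pow (m + 1)
  have hB := mul_deriv_of_re_le_boundary hz₀ hG ?_
  · have e : z₀ * ((h' / h z₀ * (z₀ / z₀) ^ (m + 1)
        - h z₀ / h z₀ * (((m + 1 : ℕ) : ℂ) * (z₀ / z₀) ^ m * (1 / z₀))) /
        ((z₀ / z₀) ^ (m + 1)) ^ 2) = z₀ * h' / h z₀ - ((m + 1 : ℕ) : ℝ) := by
      simp only [div_self hz₀, div_self hne, one_pow, ofReal_natCast]
      field_simp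
    rw [e] at hB
    obtain ⟨hB1, hB2⟩ := hB
    rw [sub_re, ofReal_re] at hB1
    rw [sub_im, ofReal_im, sub_zero] at hB2
    refine ⟨(z₀ * h' / h z₀).re, by linarith, ?_⟩
    have : ((z₀ * h' / h z₀).re : ℂ) = z₀ * h' / h z₀ := Complex.ext (by simp) (by simp [hB2])
    rw [this, div_mul_cancel₀ _ hne]
  · have h1 : ∀ᶠ z in 𝓝 z₀, z ≠ 0 := isOpen_ne.mem_nhds hz₀
    filter_upwards [h1] with z hz0 hzz
    have : ‖h z / h z₀ / (z / z₀) ^ (m + 1)‖ ≤ 1 := by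
      rw [norm_div, norm_div, norm_pow, norm_div, hone, div_one]
      have : 0 < ‖z‖ := norm_pos_iff.2 hz0
      rw [div_le_one (by positivity)]
      exact schwarz z hzz
    simp only [div_self hz₀, div_self hne, one_pow, div_one, one_re]
    exact (re_le_norm _).trans this

/-! ### Sectors, first exit points and Nunokawa's lemma. -/

theorem AbsArgLt.re_pos {w : ℂ} {c : ℝ} (h : AbsArgLt w c) (hc : c ≤ Real.pi / 2) : 0 < w.re :=
  (abs_arg_lt_pi_div_two_iff.1 (h.2.trans_le hc)).resolve_right h.1

theorem isOpen_setOf_absArgLt {c : ℝ} (hc : c ≤ Real.pi / 2) : IsOpen {w | AbsArgLt w c} := by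
  rw [isOpen_iff_mem_nhds]
  intro w hw
  have hcont : ContinuousAt arg w := continuousAt_arg (Or.inl (hw.re_pos hc))
  filter_upwards [isOpen_ne.mem_nhds hw.1, hcont.abs.eventually_lt continuousAt_const hw.2]
    with x hx1 hx2 using ⟨hx1, hx2⟩

/-- A function which takes the origin into a sector but leaves the sector somewhere in the disk
has a first exit point. -/
theorem exists_first_exit {p : ℂ → ℂ} {c : ℝ} (hc0 : 0 < c) (hc : c ≤ Real.pi / 2)
    (hp : ContinuousOn p unitDisk) (h0 : p 0 = 1)
    (hex : ¬ ∀ z ∈ unitDisk, AbsArgLt (p z) c) :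
    ∃ z₀ ∈ unitDisk, z₀ ≠ 0 ∧ (∀ z, ‖z‖ < ‖z₀‖ → AbsArgLt (p z) c) ∧
      (p z₀ = 0 ∨ p z₀ ∈ slitPlane ∧ |arg (p z₀)| = c) := by
  push Not at hex
  obtain ⟨z₁, hz₁, hbad⟩ := hex
  have hz₁' : ‖z₁‖ < 1 := by simpa [unitDisk] using hz₁
  have hsub : Metric.closedBall (0 : ℂ) ‖z₁‖ ⊆ unitDisk :=
    Metric.closedBall_subset_ball hz₁'
  have hcl : IsClosed (Metric.closedBall (0 : ℂ) ‖z₁‖ ∩ p ⁻¹' {w | AbsArgLt w c}ᶜ) :=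
    (hp.mono hsub).preimage_isClosed_of_isClosed Metric.isClosed_closedBall
      (isOpen_setOf_absArgLt hc).isClosed_compl
  have hcpt : IsCompact (Metric.closedBall (0 : ℂ) ‖z₁‖ ∩ p ⁻¹' {w | AbsArgLt w c}ᶜ) :=
    (isCompact_closedBall (0 : ℂ) ‖z₁‖).of_isClosed_subset hcl Set.inter_subset_left
  obtain ⟨z₀, ⟨hz₀, hz₀bad⟩, hmin⟩ := hcpt.exists_isMinOn ⟨z₁, by simp, hbad⟩
    continuous_norm.continuousOn
  have hz₀le : ‖z₀‖ ≤ ‖z₁‖ := by simpa using hz₀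
  have hin : ∀ z, ‖z‖ < ‖z₀‖ → AbsArgLt (p z) c := by
    intro z hz
    by_contra hcon
    have := hmin (show z ∈ _ from ⟨by simpa using hz.le.trans hz₀le, hcon⟩)
    exact absurd hz (not_lt.2 this)
  have hne : z₀ ≠ 0 := by
    rintro rfl
    refine hz₀bad (?_ : AbsArgLt (p 0) c)
    rw [h0]
    exact ⟨one_ne_zero, by simpa using hc0⟩
  have hr : 0 < ‖z₀‖ := norm_pos_iff.2 hne
  refine ⟨z₀, hsub hz₀, hne, hin, ?_⟩
  have hpc : ContinuousAt p z₀ := hp.continuousAt (Metric.isOpen_ball.mem_nhds (hsub hz₀))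
  have hpath : Tendsto (fun t : ℝ => (t : ℂ) * z₀) (𝓝[<] 1) (𝓝 z₀) := by
    have : Continuous fun t : ℝ => (t : ℂ) * z₀ := by fun_prop
    simpa using (this.tendsto 1).mono_left nhdsWithin_le_nhds
  have hpin : ∀ᶠ t : ℝ in 𝓝[<] 1, AbsArgLt (p ((t : ℂ) * z₀)) c := by
    have h0 : ∀ᶠ t : ℝ in 𝓝[<] 1, 0 < t := nhdsWithin_le_nhds (Ioi_mem_nhds one_pos)
    filter_upwards [h0, self_mem_nhdsWithin] with t ht0 (ht1 : t < 1)
    refine hin _ ?_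
    rw [norm_mul, norm_real, Real.norm_of_nonneg ht0.le]
    exact mul_lt_of_lt_one_left hr ht1
  have hlim := hpc.tendsto.comp hpath
  by_cases hzero : p z₀ = 0
  · exact Or.inl hzero
  have hre : 0 ≤ (p z₀).re := ge_of_tendsto ((continuous_re.tendsto _).comp hlim)
    (hpin.mono fun t ht => (ht.re_pos hc).le)
  have hslit : p z₀ ∈ slitPlane := by
    rcases hre.lt_or_eq with h | h
    · exact Or.inl h
    · exact Or.inr fun him => hzero (Complex.ext h.symm him)
  have hle : |arg (p z₀)| ≤ c := le_of_tendsto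
    ((continuousAt_arg hslit).abs.tendsto.comp hlim) (hpin.mono fun t ht => ht.2.le)
  exact Or.inr ⟨hslit, hle.antisymm (not_lt.1 fun h => hz₀bad ⟨hzero, h⟩)⟩

theorem norm_sub_one_div_add_one_le {g : ℂ} (hg : 0 ≤ g.re) : ‖(g - 1) / (g + 1)‖ ≤ 1 := by
  rw [norm_div]
  refine div_le_one_of_le₀ ?_ (norm_nonneg _)
  rw [← sq_le_sq₀ (norm_nonneg _) (norm_nonneg _), ← normSq_eq_norm_sq, ← normSq_eq_norm_sq]
  simp only [normSq_apply, sub_re, add_re, one_re, sub_im, add_im, one_im]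
  nlinarith

theorem exp_sign_mul_pi_div_two_mul_I {σ : ℝ} (hσ : σ = 1 ∨ σ = -1) :
    exp ((σ * (Real.pi / 2) : ℝ) * I) = σ * I := by
  rcases hσ with rfl | rfl
  · simp [exp_pi_div_two_mul_I]
  · have := exp_neg_pi_div_two_mul_I
    simp only [neg_mul, one_mul, ofReal_neg, ofReal_div, ofReal_ofNat, ofReal_one] at this ⊢
    convert this using 2
    ring

/-- **Nunokawa's lemma**: the logarithmic derivative at a first exit point from a sector. -/
theorem nunokawa {p : ℂ → ℂ} {p' z₀ : ℂ} {β : ℝ} {m : ℕ} (hβ : 0 < β)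
    (hβ1 : β ≤ 1) (h0 : p 0 = 1) (hz₀ : z₀ ≠ 0)
    (hd : DifferentiableOn ℂ p (Metric.ball 0 ‖z₀‖)) (hp : HasDerivAt p p' z₀)
    (ho : (fun z => p z - 1) =o[𝓝 0] fun z => ‖z‖ ^ m)
    (hin : ∀ z, ‖z‖ < ‖z₀‖ → AbsArgLt (p z) (Real.pi / 2 * β))
    (hslit : p z₀ ∈ slitPlane) (harg : |arg (p z₀)| = Real.pi / 2 * β) :
    ∃ a k σ : ℝ, 0 < a ∧ (m + 1 : ℕ) * ((a + 1 / a) / 2) ≤ k ∧ (σ = 1 ∨ σ = -1) ∧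
      p z₀ = (a ^ β : ℝ) * exp ((σ * (Real.pi / 2 * β) : ℝ) * I) ∧
      z₀ * p' = p z₀ * ((σ * (β * k) : ℝ) * I) := by
  have hpi := Real.pi_pos
  have hβc : (β : ℂ) ≠ 0 := ofReal_ne_zero.2 hβ.ne'
  have hpne : p z₀ ≠ 0 := slitPlane_ne_zero hslit
  obtain ⟨σ, hσ, hσarg⟩ : ∃ σ : ℝ, (σ = 1 ∨ σ = -1) ∧ arg (p z₀) = σ * (Real.pi / 2 * β) := by
    rcases abs_choice (arg (p z₀)) with h | h
    · exact ⟨1, Or.inl rfl, by rw [← harg, h, one_mul]⟩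
    · exact ⟨-1, Or.inr rfl, by rw [← harg, h]; ring⟩
  have hσ2 : (σ : ℂ) ^ 2 = 1 := by rcases hσ with h | h <;> simp [h]
  have hσexp := exp_sign_mul_pi_div_two_mul_I hσ
  have hgen : ∀ z, p z ∈ slitPlane → exp (log (p z) / β) =
      (‖p z‖ ^ β⁻¹ : ℝ) * exp ((arg (p z) / β : ℝ) * I) := by
    intro z hz
    have hn : 0 < ‖p z‖ := norm_pos_iff.2 (slitPlane_ne_zero hz)
    rw [Real.rpow_def_of_pos hn, ofReal_exp, ← Complex.exp_add]
    congr 1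
    apply Complex.ext <;> simp [log_re, log_im, div_eq_mul_inv]
  have hinslit : ∀ z, ‖z‖ < ‖z₀‖ → p z ∈ slitPlane := fun z hz =>
    Or.inl ((hin z hz).re_pos (by nlinarith))
  -- `g = p^(1/β)` opens the sector to the right half-plane and sends `z₀` to `±ia`; its Cayley
  -- transform `h` is the function for Jack's lemma.
  set g : ℂ → ℂ := fun z => exp (log (p z) / β) with hg
  set a : ℝ := ‖p z₀‖ ^ β⁻¹ with ha
  have hapos : 0 < a := Real.rpow_pos_of_pos (norm_pos_iff.2 hpne) _
  have hac : (a : ℂ) ≠ 0 := ofReal_ne_zero.2 hapos.ne'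
  have hgz₀ : g z₀ = a * (σ * I) := by
    rw [hg]
    simp only
    rw [hgen z₀ hslit, hσarg, ← hσexp]
    congr 4
    field_simp
  have hgre : ∀ z, ‖z‖ < ‖z₀‖ → 0 ≤ (g z).re := by
    intro z hz
    rw [hg]
    simp only
    rw [hgen z (hinslit z hz), re_ofReal_mul, exp_ofReal_mul_I_re]
    refine mul_nonneg (Real.rpow_nonneg (norm_nonneg _) _) (Real.cos_nonneg_of_mem_Icc ?_)
    have := abs_lt.1 (hin z hz).2
    constructor
    · rw [le_div_iff₀ hβ]; linarith
    · rw [div_le_iff₀ hβ]; linarith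
  have hgd : ∀ z p', p z ∈ slitPlane → HasDerivAt p p' z →
      HasDerivAt g (g z * (p' / p z / β)) z := fun z p' hz hpz =>
    ((hpz.clog hz).div_const _).cexp
  have hg0 : g 0 = 1 := by simp [hg, h0]
  set h : ℂ → ℂ := fun z => (g z - 1) / (g z + 1) with hh
  have hhd : ∀ z g', g z + 1 ≠ 0 → HasDerivAt g g' z →
      HasDerivAt h (2 * g' / (g z + 1) ^ 2) z := by
    intro z g' hz hgz
    exact ((hgz.sub_const 1).fun_div (hgz.add_const 1) hz).congr_deriv (by ring)
  have hgne : ∀ z, 0 ≤ (g z).re → g z + 1 ≠ 0 := by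
    intro z hz hcon
    have := congrArg re hcon
    simp only [add_re, one_re, zero_re] at this
    linarith
  have hgre₀ : (g z₀).re = 0 := by rw [hgz₀]; simp
  have hgne₀ := hgne z₀ hgre₀.ge
  have hopen : ∀ z, ‖z‖ < ‖z₀‖ → DifferentiableAt ℂ p z := fun z hz =>
    hd.differentiableAt (Metric.isOpen_ball.mem_nhds (by simpa using hz))
  have hr : 0 < ‖z₀‖ := norm_pos_iff.2 hz₀
  have hho : h =o[𝓝 0] fun z => ‖z‖ ^ m := by
    refine IsBigO.trans_isLittleO ?_ ho
    -- `h` is `p` followed by a map differentiable at `1` and vanishing there, so `h = O(p - 1)`.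
    have hψ : HasDerivAt (fun w : ℂ => (exp (log w / β) - 1) / (exp (log w / β) + 1))
        (2 * (exp (log 1 / β) * (1 / 1 / β)) / (exp (log 1 / β) + 1) ^ 2) 1 := by
      have h1 : HasDerivAt (fun w : ℂ => exp (log w / β)) (exp (log 1 / β) * (1 / 1 / β)) 1 :=
        (((hasDerivAt_id (1 : ℂ)).clog one_mem_slitPlane).div_const _).cexp
      exact ((h1.sub_const 1).fun_div (h1.add_const 1) (by simp)).congr_deriv (by ring)
    have hO := hψ.isBigO_sub
    have hpt : Tendsto p (𝓝 0) (𝓝 1) := by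
      rw [← h0]
      exact (hopen 0 (by simpa using hr)).continuousAt
    simpa [Function.comp_def] using hO.comp_tendsto hpt
  obtain ⟨k, hk, hkeq⟩ := jack_lemma (h := h) hz₀ (by simp [hh, hg0])
    (fun z hz => by
      have hz' : ‖z‖ < ‖z₀‖ := by simpa using hz
      exact (hhd z _ (hgne z (hgre z hz')) (hgd z _ (hinslit z hz')
        (hopen z hz').hasDerivAt)).differentiableAt.differentiableWithinAt)
    (fun z hz => norm_sub_one_div_add_one_le (hgre z hz)) hho
    (hhd z₀ _ hgne₀ (hgd z₀ p' hslit hp)) (by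
      rw [hh]
      simp only
      rw [norm_div, div_eq_one_iff_eq (norm_ne_zero_iff.2 hgne₀),
        ← sq_eq_sq₀ (norm_nonneg _) (norm_nonneg _), ← normSq_eq_norm_sq, ← normSq_eq_norm_sq]
      simp [normSq_apply, hgre₀])
  -- Jack's relation reads `2z₀g' = k(g² - 1)`; with `g² = -a²` the factor `(a + 1/a)/2` appears.
  refine ⟨a, k * ((a + 1 / a) / 2), σ, hapos, ?_, hσ, ?_, ?_⟩
  · exact mul_le_mul_of_nonneg_right hk (by positivity)
  · rw [ha, ← Real.rpow_mul (norm_nonneg _), inv_mul_cancel₀ hβ.ne', Real.rpow_one, ← hσarg,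
      norm_mul_exp_arg_mul_I]
  · have hgsq : g z₀ ^ 2 = -(a : ℂ) ^ 2 := by
      rw [hgz₀, mul_pow, mul_pow, hσ2, I_sq]; ring
    have hgz₀ne : g z₀ ≠ 0 := exp_ne_zero _
    have e1 : z₀ * (2 * (g z₀ * (p' / p z₀ / β))) = k * (g z₀ ^ 2 - 1) := by
      have : h z₀ = (g z₀ - 1) / (g z₀ + 1) := rfl
      rw [this] at hkeq
      field_simp at hkeq ⊢
      linear_combination hkeq
    rw [hgsq, hgz₀] at e1
    field_simp at e1
    push_cast
    field_simp
    have hmul : (σ * I) * (σ * I : ℂ) = -1 := by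
      linear_combination I ^ 2 * hσ2 + I_sq
    linear_combination (σ * I : ℂ) * (-1) * e1 + 2 * z₀ * p' * a * hmul

/-! ### Polar forms and the sector lemma for `p + zp'`. -/

theorem cos_le_cos_of_mem_Icc_two_pi_sub {c v : ℝ} (hc0 : 0 ≤ c) (h1 : c ≤ v)
    (h2 : v ≤ 2 * Real.pi - c) : Real.cos v ≤ Real.cos c := by
  rcases le_total v Real.pi with h | h
  · exact Real.cos_le_cos_of_nonneg_of_le_pi hc0 h h1
  · rw [← Real.cos_two_pi_sub v]
    exact Real.cos_le_cos_of_nonneg_of_le_pi hc0 (by linarith) (by linarith)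

/-- Two polar representations of the same number, one with angle in `(-c, c)` and one with
angle, up to sign, in `[c, 2π - c]`, cannot coexist. -/
theorem polar_ne_polar {R S c θ v σ : ℝ} (hR : 0 < R) (hS : 0 < S) (hθ : |θ| < c)
    (hc : c ≤ Real.pi) (hσ : σ = 1 ∨ σ = -1) (h1 : c ≤ v) (h2 : v ≤ 2 * Real.pi - c) :
    (R : ℂ) * exp (θ * I) ≠ S * exp ((σ * v : ℝ) * I) := by
  intro heq
  have hRS : R = S := by
    have := congrArg norm heq
    rwa [norm_mul, norm_mul, norm_exp_ofReal_mul_I, norm_exp_ofReal_mul_I, norm_real, norm_real,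
      Real.norm_of_nonneg hR.le, Real.norm_of_nonneg hS.le, mul_one, mul_one] at this
  have hcos : Real.cos θ = Real.cos v := by
    have := congrArg re heq
    rw [re_ofReal_mul, re_ofReal_mul, exp_ofReal_mul_I_re, exp_ofReal_mul_I_re, hRS] at this
    have h := mul_left_cancel₀ hS.ne' this
    rcases hσ with rfl | rfl <;> simpa using h
  have hlt : Real.cos c < Real.cos θ := by
    rw [← Real.cos_abs θ]
    exact Real.cos_lt_cos_of_nonneg_of_le_pi (abs_nonneg _) hc hθ
  have := cos_le_cos_of_mem_Icc_two_pi_sub ((abs_nonneg θ).trans hθ.le) h1 h2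
  linarith

theorem AbsArgLt.ne_polar {w : ℂ} {S c v σ : ℝ} (hw : AbsArgLt w c) (hS : 0 < S)
    (hc : c ≤ Real.pi) (hσ : σ = 1 ∨ σ = -1) (h1 : c ≤ v) (h2 : v ≤ 2 * Real.pi - c) :
    w ≠ S * exp ((σ * v : ℝ) * I) := by
  rw [← norm_mul_exp_arg_mul_I w]
  exact polar_ne_polar (norm_pos_iff.2 hw.1) hS hw.2 hc hσ h1 h2

theorem one_add_ofReal_mul_I_eq_polar {σ : ℝ} (hσ : σ = 1 ∨ σ = -1) (t : ℝ) :
    (1 : ℂ) + (σ * t : ℝ) * I = (√(1 + t ^ 2) : ℝ) * exp ((σ * Real.arctan t : ℝ) * I) := by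
  have hs : √(1 + t ^ 2) ≠ 0 := by positivity
  apply Complex.ext
  · rw [re_ofReal_mul, exp_ofReal_mul_I_re]
    rcases hσ with rfl | rfl <;> simp [Real.cos_arctan, hs]
  · rw [im_ofReal_mul, exp_ofReal_mul_I_im]
    rcases hσ with rfl | rfl <;> simp [Real.sin_arctan, mul_div_cancel₀, hs]

theorem exp_ofReal_add_mul_I (x y : ℝ) :
    exp ((x + y : ℝ) * I) = exp (x * I) * exp (y * I) := by
  rw [ofReal_add, add_mul, Complex.exp_add]

/-- If `p + z p'` lies in the sector of half-angle `πα/2`, where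
`πα/2 = πβ/2 + arctan (nβ)`, then `p` lies in the sector of half-angle `πβ/2`. -/
theorem absArgLt_of_absArgLt_add_mul_deriv {p : ℂ → ℂ} {α β : ℝ} {m : ℕ} (hβ : 0 < β)
    (hβ1 : β ≤ 1) (hα : α ≤ 2)
    (hαβ : α = β + 2 / Real.pi * Real.arctan ((m + 1 : ℕ) * β))
    (hp : DifferentiableOn ℂ p unitDisk) (h0 : p 0 = 1)
    (ho : (fun z => p z - 1) =o[𝓝 0] fun z => ‖z‖ ^ m)
    (harg : ∀ z ∈ unitDisk, AbsArgLt (p z + z * deriv p z) (Real.pi / 2 * α)) :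
    ∀ z ∈ unitDisk, AbsArgLt (p z) (Real.pi / 2 * β) := by
  have hpi := Real.pi_pos
  by_contra hex
  obtain ⟨z₀, hz₀, hne, hin, hzero | ⟨hslit, habs⟩⟩ :=
    exists_first_exit (by positivity) (by nlinarith) hp.continuousOn h0 hex
  -- If `p(z₀) = 0`, the boundary lemma for `-p` makes `z₀p'(z₀)` a negative real, of argument `π ≥
  -- πα/2`.
  · have hd := (hp.differentiableAt (Metric.isOpen_ball.mem_nhds hz₀)).hasDerivAt
    obtain ⟨h1, h2⟩ := mul_deriv_of_re_le_boundary hne hd.neg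
      (Eventually.of_forall fun z hz => by
        have := (hin z hz).re_pos (by nlinarith)
        simp only [Pi.neg_apply, hzero, neg_re, zero_re, neg_zero]
        linarith)
    have hw := harg z₀ hz₀
    rw [hzero, zero_add] at hw
    rw [mul_neg, neg_re] at h1
    rw [mul_neg, neg_im, neg_eq_zero] at h2
    have hre : (z₀ * deriv p z₀).re < 0 :=
      lt_of_le_of_ne (by linarith) fun h => hw.1 (Complex.ext h h2)
    have hlt := hw.2
    rw [arg_eq_pi_iff.2 ⟨hre, h2⟩, abs_of_pos hpi] at hlt
    nlinarith
  · have hd := (hp.differentiableAt (Metric.isOpen_ball.mem_nhds hz₀)).hasDerivAt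
    have hsub : Metric.ball (0 : ℂ) ‖z₀‖ ⊆ unitDisk :=
      Metric.ball_subset_ball (by simpa [unitDisk] using (Metric.mem_ball.1 hz₀).le)
    obtain ⟨a, k, σ, ha, hk, hσ, hpz, hzp⟩ :=
      nunokawa hβ hβ1 h0 hne (hp.mono hsub) hd ho hin hslit habs
    have hka : ((m + 1 : ℕ) : ℝ) ≤ k := by
      refine le_trans ?_ hk
      refine le_mul_of_one_le_right (by positivity) ?_
      have : 0 ≤ (a - 1) ^ 2 / a := by positivity
      have e : (a - 1) ^ 2 / a = a + 1 / a - 2 := by field_simp; ring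
      linarith
    have hαv : Real.pi / 2 * α = Real.pi / 2 * β + Real.arctan ((m + 1 : ℕ) * β) := by
      rw [hαβ]; field_simp
    have hmono : Real.arctan ((m + 1 : ℕ) * β) ≤ Real.arctan (β * k) :=
      Real.arctan_strictMono.monotone (by nlinarith)
    have hlt := Real.arctan_lt_pi_div_two (β * k)
    refine (harg z₀ hz₀).ne_polar (S := a ^ β * √(1 + (β * k) ^ 2)) (σ := σ)
      (v := Real.pi / 2 * β + Real.arctan (β * k)) (by positivity) (by nlinarith) hσ (by linarith)
      (by nlinarith) ?_
    have hpol := one_add_ofReal_mul_I_eq_polar hσ (β * k)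
    rw [hzp, ← mul_one_add, hpol, hpz, mul_add σ, exp_ofReal_add_mul_I,
      ofReal_mul (a ^ β)]
    ring

/-! ### The bound `ϕ` and the sector lemma for `P² + zP'`. -/

/-- Weighted AM-GM with weights `(1 ± μ)/2`, chosen so that the powers of `a` cancel; equality holds
at `a² = (1+μ)/(1-μ)`. -/
theorem half_rpow_add_rpow_ge {a μ : ℝ} (ha : 0 < a) (hμ0 : 0 < μ) (hμ1 : μ < 1) :
    1 / (1 - μ) * ((1 - μ) / (1 + μ)) ^ ((1 + μ) / 2) ≤ (a + 1 / a) / 2 / a ^ μ := by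
  have h1 : 0 < 1 - μ := by linarith
  have h2 : 0 < 1 + μ := by linarith
  have amgm := Real.geom_mean_le_arith_mean2_weighted (w₁ := (1 + μ) / 2) (w₂ := (1 - μ) / 2)
    (p₁ := a / a ^ μ / (1 + μ)) (p₂ := 1 / a / a ^ μ / (1 - μ)) (by positivity) (by positivity)
    (by positivity) (by positivity) (by ring)
  convert amgm using 1
  · rw [← Real.exp_log (show 0 < 1 / (1 - μ) * ((1 - μ) / (1 + μ)) ^ ((1 + μ) / 2) by positivity),
      ← Real.exp_log (show 0 < (a / a ^ μ / (1 + μ)) ^ ((1 + μ) / 2) *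
        (1 / a / a ^ μ / (1 - μ)) ^ ((1 - μ) / 2) by positivity)]
    congr 1
    rw [Real.log_mul (by positivity) (by positivity), Real.log_mul (by positivity) (by positivity),
      Real.log_rpow (by positivity), Real.log_rpow (by positivity), Real.log_rpow (by positivity),
      Real.log_div (by positivity) (by positivity), Real.log_div (by positivity) (by positivity),
      Real.log_div (by positivity) (by positivity), Real.log_div (by positivity) (by positivity),
      Real.log_div (by positivity) (by positivity), Real.log_div (by positivity) (by positivity),
      Real.log_div (by positivity) (by positivity), Real.log_rpow ha, Real.log_one]
    ring
  · field_simp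

/-- A larger `t` lowers the arctangent. At `μ = 1` the cosine vanishes and `t` plays no role. -/
theorem phi_le_of_le {n : ℕ} {μ t : ℝ} (hμ0 : 0 < μ) (hμ1 : μ ≤ 1)
    (h : μ < 1 → n * μ / (1 - μ) * ((1 - μ) / (1 + μ)) ^ ((1 + μ) / 2) ≤ t) :
    phi n μ ≤ Real.pi / 2 * (μ + 1) -
      Real.arctan (Real.cos (μ * Real.pi / 2) / (Real.sin (μ * Real.pi / 2) + t)) := by
  rcases hμ1.lt_or_eq with hlt | rfl
  · have hpi := Real.pi_pos
    have hcos : 0 ≤ Real.cos (μ * Real.pi / 2) :=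
      Real.cos_nonneg_of_mem_Icc ⟨by nlinarith, by nlinarith⟩
    have hsin : 0 < Real.sin (μ * Real.pi / 2) :=
      Real.sin_pos_of_pos_of_lt_pi (by positivity) (by nlinarith)
    have h1 : 0 < 1 - μ := by linarith
    have := h hlt
    unfold phi
    gcongr
  · rw [phi_one]
    simp only [one_mul, Real.cos_pi_div_two, zero_div, Real.arctan_zero]
    linarith

theorem phi_le_pi {n : ℕ} {μ : ℝ} (hμ0 : 0 < μ) (hμ1 : μ ≤ 1) : phi n μ ≤ Real.pi := by
  have hpi := Real.pi_pos
  have hcos : 0 ≤ Real.cos (μ * Real.pi / 2) :=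
    Real.cos_nonneg_of_mem_Icc ⟨by nlinarith, by nlinarith⟩
  have hsin : 0 ≤ Real.sin (μ * Real.pi / 2) :=
    Real.sin_nonneg_of_nonneg_of_le_pi (by positivity) (by nlinarith)
  have h1 : 0 ≤ 1 - μ := by linarith
  have h2 : 0 ≤ 1 + μ := by linarith
  have := Real.arctan_nonneg.2 (show 0 ≤ Real.cos (μ * Real.pi / 2) /
      (Real.sin (μ * Real.pi / 2) +
        n * μ / (1 - μ) * ((1 - μ) / (1 + μ)) ^ ((1 + μ) / 2)) by positivity)
  unfold phi
  nlinarith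

/-- If `P² + z P'` always has an argument in `(-c, c)`, where `c ≤ ϕ(μ)`, then `P` lies in the
sector of half-angle `πμ/2`. -/
theorem absArgLt_of_sq_add_mul_deriv {P : ℂ → ℂ} {μ c : ℝ} {m : ℕ} (hμ0 : 0 < μ) (hμ1 : μ ≤ 1)
    (hc : c ≤ phi (m + 1) μ) (hP : DifferentiableOn ℂ P unitDisk) (h0 : P 0 = 1)
    (hPne : ∀ z ∈ unitDisk, P z ≠ 0)
    (ho : (fun z => P z - 1) =o[𝓝 0] fun z => ‖z‖ ^ m)
    (harg : ∀ z ∈ unitDisk, ∃ R θ : ℝ, 0 < R ∧ |θ| < c ∧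
      P z ^ 2 + z * deriv P z = R * exp (θ * I)) :
    ∀ z ∈ unitDisk, AbsArgLt (P z) (Real.pi / 2 * μ) := by
  have hpi := Real.pi_pos
  have hcpi : c ≤ Real.pi := hc.trans (phi_le_pi hμ0 hμ1)
  by_contra hex
  obtain ⟨z₀, hz₀, hne, hin, hzero | ⟨hslit, habs⟩⟩ :=
    exists_first_exit (by positivity) (by nlinarith) hP.continuousOn h0 hex
  · exact hPne z₀ hz₀ hzero
  have hd := (hP.differentiableAt (Metric.isOpen_ball.mem_nhds hz₀)).hasDerivAt
  have hsub : Metric.ball (0 : ℂ) ‖z₀‖ ⊆ unitDisk :=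
    Metric.ball_subset_ball (by simpa [unitDisk] using (Metric.mem_ball.1 hz₀).le)
  obtain ⟨a, k, σ, ha, hk, hσ, hpz, hzp⟩ :=
    nunokawa hμ0 hμ1 h0 hne (hP.mono hsub) hd ho hin hslit habs
  obtain ⟨R, θ, hR, hθ, hpol⟩ := harg z₀ hz₀
  have haμ : 0 < a ^ μ := Real.rpow_pos_of_pos ha _
  have hkpos : 0 < k := lt_of_lt_of_le (by positivity) hk
  have ht : 0 < μ * k / a ^ μ := by positivity
  have hphi := phi_le_of_le (n := m + 1) hμ0 hμ1 (t := μ * k / a ^ μ) (fun hlt => by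
    have h1 : 0 < 1 - μ := by linarith
    have h2 := half_rpow_add_rpow_ge ha hμ0 hlt
    calc ((m + 1 : ℕ) : ℝ) * μ / (1 - μ) * ((1 - μ) / (1 + μ)) ^ ((1 + μ) / 2)
        = (m + 1 : ℕ) * μ * (1 / (1 - μ) * ((1 - μ) / (1 + μ)) ^ ((1 + μ) / 2)) := by ring
      _ ≤ (m + 1 : ℕ) * μ * ((a + 1 / a) / 2 / a ^ μ) := by gcongr
      _ = μ * ((m + 1 : ℕ) * ((a + 1 / a) / 2)) / a ^ μ := by ring
      _ ≤ μ * k / a ^ μ := by gcongr)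
  set t := μ * k / a ^ μ with ht_def
  have hcos : 0 ≤ Real.cos (μ * Real.pi / 2) :=
    Real.cos_nonneg_of_mem_Icc ⟨by nlinarith, by nlinarith⟩
  have hsin : 0 ≤ Real.sin (μ * Real.pi / 2) :=
    Real.sin_nonneg_of_nonneg_of_le_pi (by positivity) (by nlinarith)
  set Y := Real.sin (μ * Real.pi / 2) + t with hY
  set X := Real.cos (μ * Real.pi / 2) with hX
  have hYpos : 0 < Y := by positivity
  clear_value X Y t
  have harc : 0 ≤ Real.arctan (X / Y) := Real.arctan_nonneg.2 (by positivity)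
  refine polar_ne_polar (S := a ^ μ * a ^ μ * (Y * √(1 + (X / Y) ^ 2))) (σ := σ)
    (v := Real.pi / 2 * μ + (Real.pi / 2 - Real.arctan (X / Y))) hR (by positivity) hθ hcpi hσ
    (by linarith) (by nlinarith) ?_
  have hσ2 : (σ : ℂ) * σ = 1 := by rcases hσ with rfl | rfl <;> simp
  have hrot := exp_sign_mul_pi_div_two_mul_I hσ
  -- The left side is `X + iσY = iσY(1 - iσX/Y)`, of angle `σ(π/2 - arctan(X/Y))`.
  have hXY : exp ((σ * (Real.pi / 2 * μ) : ℝ) * I) + (σ * t : ℝ) * I =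
      (Y * √(1 + (X / Y) ^ 2) : ℝ) * exp ((σ * (Real.pi / 2 - Real.arctan (X / Y)) : ℝ) * I) := by
    have hσneg : -σ = 1 ∨ -σ = -1 := by rcases hσ with rfl | rfl <;> simp
    have hpol := one_add_ofReal_mul_I_eq_polar hσneg (X / Y)
    have hYc : (Y : ℂ) ≠ 0 := ofReal_ne_zero.2 hYpos.ne'
    have e1 : exp ((σ * (Real.pi / 2 * μ) : ℝ) * I) + (σ * t : ℝ) * I = X + (σ * Y : ℝ) * I := by
      rw [exp_mul_I, ← ofReal_cos, ← ofReal_sin, hX, hY]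
      rcases hσ with rfl | rfl
      · rw [one_mul, show Real.pi / 2 * μ = μ * Real.pi / 2 by ring]
        push_cast; ring
      · rw [neg_one_mul, Real.cos_neg, Real.sin_neg,
          show Real.pi / 2 * μ = μ * Real.pi / 2 by ring]
        push_cast; ring
    rw [e1, show σ * (Real.pi / 2 - Real.arctan (X / Y)) =
      σ * (Real.pi / 2) + -σ * Real.arctan (X / Y) by ring, exp_ofReal_add_mul_I,
      hrot, ofReal_mul Y]
    calc (X : ℂ) + (σ * Y : ℝ) * I = Y * (σ * I) * (1 + (-σ * (X / Y) : ℝ) * I) := by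
          push_cast
          field_simp
          linear_combination ((X : ℂ) * I ^ 2) * hσ2 + (X : ℂ) * I_sq
      _ = _ := by rw [hpol]; ring
  have hfac : P z₀ ^ 2 + z₀ * deriv P z₀ = P z₀ * ((a ^ μ : ℝ) *
      (exp ((σ * (Real.pi / 2 * μ) : ℝ) * I) + (σ * t : ℝ) * I)) := by
    have : (σ * (μ * k) : ℝ) = a ^ μ * (σ * t) := by rw [ht_def]; field_simp
    rw [hzp, sq, ← mul_add, mul_add (ofReal (a ^ μ)), ← hpz, this, ofReal_mul (a ^ μ), mul_assoc]
  rw [← hpol, hfac, hXY, hpz, mul_add σ (Real.pi / 2 * μ), exp_ofReal_add_mul_I,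
    ofReal_mul (a ^ μ * a ^ μ), ofReal_mul (a ^ μ)]
  ring

/-! ### Power series and assembly of the proof. -/

theorem exists_eq_add_pow_mul_of_mem_classA {n : ℕ} {f : ℂ → ℂ} (hf : f ∈ classA n) :
    ∃ F : ℂ → ℂ, DifferentiableOn ℂ F unitDisk ∧
      ∀ z ∈ unitDisk, f z = z + z ^ (n + 1) * F z := by
  obtain ⟨-, a, ha⟩ := hf
  refine ⟨fun z => ∑' k, a (n + 1 + k) * z ^ k, ?_, fun z hz => ?_⟩
  · intro z hz
    have hz1 : ‖z‖ < 1 := by simpa [unitDisk] using hz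
    obtain ⟨r, hzr, hr1⟩ := exists_between hz1
    have hr0 : 0 < r := (norm_nonneg z).trans_lt hzr
    -- Convergence at the real point `r` supplies the Weierstrass majorant on the ball of radius
    -- `r`.
    have hsum : Summable fun k => ‖a (n + 1 + k)‖ * r ^ k := by
      have h := (ha (r : ℂ) (by simpa [unitDisk, abs_of_pos hr0] using hr1)).summable.norm
      refine (h.mul_left ((r ^ (n + 1))⁻¹)).congr fun k => ?_
      rw [norm_mul, norm_pow, norm_real, Real.norm_of_nonneg hr0.le]
      field_simp
      ring
    have hd := differentiableOn_tsum_of_summable_norm (F := fun k z => a (n + 1 + k) * z ^ k)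
      (U := Metric.ball 0 r) hsum (fun k => by fun_prop) Metric.isOpen_ball (fun k w hw => by
        rw [norm_mul, norm_pow]
        have : ‖w‖ ≤ r := by simpa using (mem_ball_zero_iff.1 hw).le
        gcongr)
    exact (hd.differentiableAt (Metric.isOpen_ball.mem_nhds
      (by simpa using hzr))).differentiableWithinAt
  · rw [← tsum_mul_left, ← sub_eq_iff_eq_add', ← (ha z hz).tsum_eq]
    exact tsum_congr fun k => by ring

theorem isLittleO_pow_succ_mul {G : ℂ → ℂ} (hG : ContinuousAt G 0) (m : ℕ) :
    (fun z => z ^ (m + 1) * G z) =o[𝓝 0] fun z => ‖z‖ ^ m := by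
  have h1 : (fun z : ℂ => z ^ m * (z * G z)) =o[𝓝 0] fun z => ‖z‖ ^ m * 1 := by
    refine IsBigO.mul_isLittleO ?_ ?_
    · exact IsBigO.of_bound 1 (Eventually.of_forall fun z => by simp)
    · rw [isLittleO_one_iff]
      simpa using (continuousAt_id (x := (0 : ℂ))).fun_mul hG |>.tendsto
  refine h1.congr (fun z => by ring) (fun z => by ring)

/-- The relation between the three opening angles bounds the middle one by `π/2`. -/
theorem le_one_of_add_le_two {n : ℕ} (hn : 1 ≤ n) {α β γ : ℝ} (hγ : 0 < γ)
    (hαβ : α = β + 2 / Real.pi * Real.arctan (n * β))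
    (hβγ : β = γ + 2 / Real.pi * Real.arctan (n * γ)) (h : α + γ ≤ 2) : β ≤ 1 := by
  by_contra! hβ
  have hpi := Real.pi_pos
  have hn0 : (0 : ℝ) < n := by exact_mod_cast hn
  have hmono : Real.arctan (n * γ) ≤ Real.arctan (n * β) := by
    refine Real.arctan_strictMono.monotone (mul_le_mul_of_nonneg_left ?_ hn0.le)
    have : 0 ≤ Real.arctan (n * γ) := Real.arctan_nonneg.2 (by positivity)
    have : 0 ≤ 2 / Real.pi * Real.arctan (n * γ) := by positivity
    linarith
  -- Hence `α + γ - 2β = (2/π)(arctan nβ - arctan nγ) ≥ 0`, so `2β ≤ 2`.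
  have := mul_le_mul_of_nonneg_left hmono (show 0 ≤ 2 / Real.pi by positivity)
  linarith

theorem theorem1 (n : ℕ) (hn : 1 ≤ n) (f : ℂ → ℂ) (hf : f ∈ classA n)
    (α β γ μ : ℝ) (hα : 0 < α) (hγ : 0 < γ) (hμ0 : 0 < μ) (hμ1 : μ ≤ 1)
    (hαβ : α = β + 2 / Real.pi * Real.arctan (n * β))
    (hβγ : β = γ + 2 / Real.pi * Real.arctan (n * γ))
    (hφ : Real.pi / 2 * (α + γ) ≤ phi n μ)
    (harg : ∀ z ∈ unitDisk, AbsArgLt (deriv f z + z * deriv (deriv f) z) (Real.pi / 2 * α)) :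
    f ∈ classSTS n μ := by
  have hpi := Real.pi_pos
  have hsum : α + γ ≤ 2 := by
    have := hφ.trans (phi_le_pi hμ0 hμ1)
    by_contra! hcon
    nlinarith
  have hβ1 := le_one_of_add_le_two hn hγ hαβ hβγ hsum
  have hn0 : (0 : ℝ) < n := by exact_mod_cast hn
  have hγβ : γ ≤ β := by
    have : 0 ≤ Real.arctan (n * γ) := Real.arctan_nonneg.2 (by positivity)
    have : 0 ≤ 2 / Real.pi * Real.arctan (n * γ) := by positivity
    linarith
  refine ⟨hf, hμ0, hμ1, ?_⟩
  obtain ⟨F, hF, hfF⟩ := exists_eq_add_pow_mul_of_mem_classA hf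
  obtain ⟨m, rfl⟩ : ∃ m, n = m + 1 := ⟨n - 1, by omega⟩
  have hopen : IsOpen unitDisk := Metric.isOpen_ball
  have h0mem : (0 : ℂ) ∈ unitDisk := by simp [unitDisk]
  have hF' : DifferentiableOn ℂ (deriv F) unitDisk := hF.deriv hopen
  set q : ℂ → ℂ := fun z => 1 + z ^ (m + 1) * F z with hq
  have hqd : DifferentiableOn ℂ q unitDisk := by fun_prop
  have hq0 : q 0 = 1 := by simp [hq]
  have hfd : DifferentiableOn ℂ (deriv f) unitDisk := hf.1.differentiableOn.deriv hopen
  have hfq : ∀ z ∈ unitDisk, f z = z * q z := fun z hz => by rw [hfF z hz]; simp only [hq]; ring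
  have hderiv : ∀ z ∈ unitDisk, deriv f z = q z + z * deriv q z := by
    intro z hz
    have hqz := (hqd.differentiableAt (hopen.mem_nhds hz)).hasDerivAt
    have h1 := ((hasDerivAt_id z).fun_mul hqz).congr_of_eventuallyEq
      (f₁ := f) (by filter_upwards [hopen.mem_nhds hz] with w hw using hfq w hw)
    rw [h1.deriv]
    simp
  set G : ℂ → ℂ := fun z => (m + 2 : ℂ) * F z + z * deriv F z with hG
  have hGd : DifferentiableOn ℂ G unitDisk := by fun_prop
  have hfG : ∀ z ∈ unitDisk, deriv f z = 1 + z ^ (m + 1) * G z := by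
    intro z hz
    have hFz := (hF.differentiableAt (hopen.mem_nhds hz)).hasDerivAt
    have hqz : HasDerivAt q _ z := ((hasDerivAt_pow (m + 1) z).fun_mul hFz).const_add 1
    rw [hderiv z hz, hqz.deriv, hq, hG]
    simp only [Nat.add_sub_cancel]
    push_cast
    ring
  have hcont : ∀ {H : ℂ → ℂ}, DifferentiableOn ℂ H unitDisk → ContinuousAt H 0 := fun hH =>
    (hH.differentiableAt (hopen.mem_nhds h0mem)).continuousAt
  have hf0 : deriv f 0 = 1 := by simp [hfG 0 h0mem]
  have hfarg : ∀ z ∈ unitDisk, AbsArgLt (deriv f z) (Real.pi / 2 * β) := by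
    refine absArgLt_of_absArgLt_add_mul_deriv (hγ.trans_le hγβ) hβ1 (by linarith) hαβ hfd hf0 ?_
      harg
    refine (isLittleO_pow_succ_mul (hcont hGd) m).congr' ?_ EventuallyEq.rfl
    filter_upwards [hopen.mem_nhds h0mem] with z hz
    rw [hfG z hz, add_sub_cancel_left]
  have hqarg : ∀ z ∈ unitDisk, AbsArgLt (q z) (Real.pi / 2 * γ) := by
    refine absArgLt_of_absArgLt_add_mul_deriv hγ (hγβ.trans hβ1) (by linarith) hβγ hqd hq0 ?_
      (fun z hz => hderiv z hz ▸ hfarg z hz)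
    simpa [hq] using isLittleO_pow_succ_mul (hcont hF) m
  have hqne : ∀ z ∈ unitDisk, q z ≠ 0 := fun z hz => (hqarg z hz).1
  have hPd : DifferentiableOn ℂ (fun z => deriv f z / q z) unitDisk := hfd.div hqd hqne
  have hPo : (fun z => deriv f z / q z - 1) =o[𝓝 0] fun z => ‖z‖ ^ m := by
    -- `f' - q = z^(m+1)(G - F)`, so `P - 1` vanishes to order `m + 1`.
    have hH : DifferentiableOn ℂ (fun z => (G z - F z) / q z) unitDisk := (hGd.sub hF).div hqd hqne
    refine (isLittleO_pow_succ_mul (hcont hH) m).congr' ?_ EventuallyEq.rfl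
    filter_upwards [hopen.mem_nhds h0mem] with z hz
    have hne := hqne z hz
    rw [div_sub_one hne, hfG z hz, mul_div_assoc', hq]
    ring
  have hP := absArgLt_of_sq_add_mul_deriv (P := fun z => deriv f z / q z) hμ0 hμ1 hφ hPd
    (by simp [hf0, hq0]) (fun z hz => div_ne_zero (hfarg z hz).1 (hqne z hz)) hPo (by
      intro z hz
      have hne := hqne z hz
      have hw := harg z hz
      set w := deriv f z + z * deriv (deriv f) z with hw_def
      -- The difference of arguments serves directly as the angle of `w/q`, with no reduction to a
      -- principal value.
      refine ⟨‖w‖ / ‖q z‖, arg w - arg (q z),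
        div_pos (norm_pos_iff.2 hw.1) (norm_pos_iff.2 hne), ?_, ?_⟩
      · calc |arg w - arg (q z)| ≤ |arg w| + |arg (q z)| := abs_sub _ _
          _ < Real.pi / 2 * (α + γ) := by linarith [hw.2, (hqarg z hz).2]
      · have hPz := ((hfd.differentiableAt (hopen.mem_nhds hz)).hasDerivAt.fun_div
          (hqd.differentiableAt (hopen.mem_nhds hz)).hasDerivAt hne).deriv
        rw [hPz]
        trans w / q z
        · rw [hw_def]
          field_simp
          linear_combination (deriv f z) * hderiv z hz
        · conv_lhs => rw [← norm_mul_exp_arg_mul_I w, ← norm_mul_exp_arg_mul_I (q z)]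
          rw [ofReal_sub, sub_mul, Complex.exp_sub, ofReal_div]
          field_simp)
  intro z hz hz0
  have hfz := hfq z hz
  refine ⟨by rw [hfz]; exact mul_ne_zero hz0 (hqne z hz), ?_⟩
  rw [hfz, mul_div_mul_left _ _ hz0]
  exact hP z hz
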